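/- Let $\sigma\ge 0$. For a measurable function $f\in L^\infty_{\mathrm{loc}}(\mathbb R)$ consider the leaky integrate-and-fire system $\dot x=-\sigma x+f(t)$ with threshold $1$ and reset $0$; its firing map is $$\Phi_f(t)=\inf\Big\{s>t:\ e^{\sigma t}\le\int_t^{s}[f(u)-\sigma]e^{\sigma u}\,du\Big\},\qquad t\in\mathbb R,$$ its rotation number is $\varrho(\Phi_f)=\lim_{n\to\infty}\Phi_f^n(t)/n$, and its empirical interspike-interval distribution for the run of length $n$ started at $(t,0)$ is $$\omega^{f}_{n,t}=\frac1n\sum_{i=0}^{n-1}\delta_{\Phi_f^{i+1}(t)-\Phi_f^{i}(t)}.$$ The space $L^\infty_{\mathrm{loc}}(\mathbb R)$ carries the metric $d(f,g)=\sum_{k\ge1}2^{-k}\frac{\|f-g\|_{L^\infty([-k,k])}}{1+\|f-g\|_{L^\infty([-k,k])}}$, and for compactly supported Borel probability measures on $\mathbb R$ the Fortet–Mourier distance is $d_F(\mu,\nu)=\sup\{|\int g\,d\mu-\int g\,d\nu|:\ g:\mathbb R\to\mathbb R\ \text{is 1-Lipschitz}\}$. Proposition. Let $f_{\theta_1}\in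 L^\infty_{\mathrm{loc}}(\mathbb R)$ satisfy $f_{\theta_1}(t+1)=f_{\theta_1}(t)$ for a.e. $t$ and, for some $\varsigma>0$, $f_{\theta_1}(t)-\sigma>\varsigma$ for a.e. $t$, and suppose that the rotation number of $\Phi_{\theta_1}=\Phi_{f_{\theta_1}}$ is irrational. Then the map $\Phi_{\theta_1}\bmod 1$ of $[0,1]$ has a unique invariant Borel probability measure $\mu^{(\theta_1)}$; let $\mu^{(\theta_1)}_{\mathrm{ISI}}$ be the image of $\mu^{(\theta_1)}$ under $t\mapsto\Phi_{\theta_1}(t)-t$. For every $\varepsilon>0$ there is a neighbourhood $\mathcal U$ of $f_{\theta_1}$ in $L^\infty_{\mathrm{loc}}(\mathbb R)$ such that for every $f_{\theta_2}\in\mathcal U$ with $f_{\theta_2}(t+1)=f_{\theta_2}(t)$ for a.e. $t$, and for every $t\in\mathbb R$, the measures $\omega^{(\theta_2)}_{n,t}=\omega^{f_{\theta_2}}_{n,t}$ converge weakly as $n\to\infty$ to a Borel probability measure on $\mathbb R$, and $$d_F\Big(\lim_{n\to\infty}\omega^{(\theta_2)}_{n,t},\ \mu^{(\theta_1)}_{\mathrm{ISI}}\Big)<\varepsilon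 .$$ -/

import Mathlib

open MeasureTheory Filter Topology
open scoped ENNReal BoundedContinuousFunction

noncomputable section

namespace IntegrateFire

/-- Measurable, essentially bounded on every compact set: the space `L^∞_loc(ℝ)`. -/
def MemLInftyLoc (f : ℝ → ℝ) : Prop :=
  ∀ K : Set ℝ, IsCompact K → MemLp f ∞ (volume.restrict K)

/-- The seminorm distance `ess sup_{[-k,k]} |f - g|`; it is finite for `f, g ∈ L^∞_loc(ℝ)`. -/
def supDistOn (k : ℕ) (f g : ℝ → ℝ) : ℝ :=
  (eLpNorm (fun t => f t - g t) ∞ (volume.restrict (Set.Icc (-(k : ℝ)) k))).toReal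

/-- The Fréchet metric of `L^∞_loc(ℝ)`:
`∑_{k ≥ 1} 2^{-k} ‖f - g‖_{[-k,k]} / (1 + ‖f - g‖_{[-k,k]})`. -/
def distLInftyLoc (f g : ℝ → ℝ) : ℝ :=
  ∑' k : ℕ, (1 / 2 : ℝ) ^ (k + 1) * (supDistOn (k + 1) f g / (1 + supDistOn (k + 1) f g))

/-- `U` is a neighbourhood of `f` in the topology of `L^∞_loc(ℝ)`. -/
def IsNhdLInftyLoc (U : Set (ℝ → ℝ)) (f : ℝ → ℝ) : Prop :=
  ∃ δ : ℝ, 0 < δ ∧ ∀ g : ℝ → ℝ, MemLInftyLoc g → distLInftyLoc f g < δ → g ∈ U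

/-- Periodicity with period `1`, almost everywhere. -/
def OnePeriodic (f : ℝ → ℝ) : Prop :=
  ∀ᵐ t : ℝ, f (t + 1) = f t

/-- The firing map of `x' = -σ x + f(t)` with threshold `1` and reset `0`. -/
def firingMap (σ : ℝ) (f : ℝ → ℝ) (t : ℝ) : ℝ :=
  sInf {s : ℝ | t < s ∧
    Real.exp (σ * t) ≤ ∫ u in t..s, (f u - σ) * Real.exp (σ * u)}

/-- The rotation number `lim Φⁿ(t) / n`, evaluated at `t = 0`. For a lift of an orientation
preserving circle homeomorphism the limit exists and is the same for all `t`. -/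
def rotationNumber (Φ : ℝ → ℝ) : ℝ :=
  limUnder atTop (fun n : ℕ => Φ^[n] 0 / (n : ℝ))

/-- `μ` is an invariant Borel probability measure of the firing phase map `Φ mod 1`, viewed as
a self-map of `[0,1]`. -/
structure IsInvariantPhaseMeasure (Φ : ℝ → ℝ) (μ : Measure ℝ) : Prop where
  prob : IsProbabilityMeasure μ
  support : μ (Set.Icc 0 1)ᶜ = 0
  invariant : MeasurePreserving (fun t => Int.fract (Φ t)) μ μ

/-- The interspike-interval distribution: the image of the phase measure `μ` under the
displacement `Ψ(t) = Φ(t) - t`. -/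
def isiDistribution (Φ : ℝ → ℝ) (μ : Measure ℝ) : Measure ℝ :=
  μ.map (fun t => Φ t - t)

/-- The `i`-th interspike interval of the run started at `(t, 0)`. -/
def isi (Φ : ℝ → ℝ) (t : ℝ) (i : ℕ) : ℝ :=
  Φ^[i + 1] t - Φ^[i] t

/-- The empirical interspike-interval distribution of the run of length `n` from `(t, 0)`. -/
def empiricalISI (Φ : ℝ → ℝ) (n : ℕ) (t : ℝ) : Measure ℝ :=
  (n : ℝ≥0∞)⁻¹ • ∑ i ∈ Finset.range n, Measure.dirac (isi Φ t i)

/-- Weak convergence of measures on `ℝ`. -/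
def WeaklyConverges (μs : ℕ → Measure ℝ) (ν : Measure ℝ) : Prop :=
  ∀ g : ℝ →ᵇ ℝ, Tendsto (fun n => ∫ x, g x ∂(μs n)) atTop (𝓝 (∫ x, g x ∂ν))

/-- The Fortet–Mourier distance: supremum over all `1`-Lipschitz functions (an extended
nonnegative real). It is used for compactly supported probability measures on `ℝ`, for which
every Lipschitz function is integrable. -/
def fortetMourierDist (μ ν : Measure ℝ) : ℝ≥0∞ :=
  ⨆ (g : ℝ → ℝ) (_ : LipschitzWith 1 g),
    ENNReal.ofReal |(∫ x, g x ∂μ) - ∫ x, g x ∂ν|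

end IntegrateFire

end

namespace IntegrateFire

/-! ### Averages of bounded sequences -/

/-! The firing map is a monotone Lipschitz lift of a degree one circle map, and the statement is a
stability result for its Birkhoff averages. The core is `exists_oscillation_bound`: if the
translation number `ρ` is irrational, Birkhoff sums of `c - id` over length `N` vary with the
starting point by at most `N * δ + C`, with `C` independent of the monotone degree one map `c`.
Moving the start `k` steps along the orbit and back by an integer `m` changes the sum of `c` by `N *
(k * ρ - m) + O(k)`, whatever `c` is. Choosing `q * ρ - p` small and positive, monotonicity traps
any start between two consecutive shifts, and comparison with `c = id` cancels the drift. An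
`L`-Lipschitz periodic `h` enters through `c = id + h / L`, so the estimate is uniform over a
Lipschitz class. Unique ergodicity follows without any conjugacy to a rotation.

For the perturbation, one block length `N` makes all block averages of the unperturbed system close
to the space average, for all starts and all 1-Lipschitz test functions at once. Nearby inputs give
uniformly nearby firing maps (`abs_firingMap_sub_firingMap_le`), hence nearby interspike intervals
over `N` spikes. Cutting a perturbed run into such blocks, and restarting the unperturbed system at
each one, controls its averages for all time. The perturbed limits exist by
`exists_tendsto_birkhoff`, for rational and irrational rotation number alike. -/

theorem abs_sum_range_mul_le {a : ℕ → ℝ} {N K : ℕ} {B ε : ℝ} (hB : ∀ i, |a i| ≤ B)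
    (hε : 0 ≤ ε) (h : ∀ k, K ≤ k → |∑ i ∈ Finset.range N, a (k * N + i)| ≤ N * ε) (m : ℕ) :
    |∑ i ∈ Finset.range (m * N), a i| ≤ K * N * B + m * N * ε := by
  have hB0 : 0 ≤ B := (abs_nonneg _).trans (hB 0)
  have triv : ∀ n, |∑ i ∈ Finset.range n, a i| ≤ n * B := fun n =>
    (Finset.abs_sum_le_sum_abs _ _).trans
      ((Finset.sum_le_sum fun i _ => hB i).trans (by simp))
  induction m with
  | zero => simp; positivity
  | succ m ih =>
    rcases lt_or_ge m K with hm | hm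
    · refine (triv _).trans ?_
      have h1 : ((m + 1 : ℕ) : ℝ) ≤ K := by exact_mod_cast hm
      have h2 : ((m + 1 : ℕ) : ℝ) * (N * B) ≤ K * (N * B) := by gcongr
      have h3 : 0 ≤ ((m + 1 : ℕ) : ℝ) * N * ε := by positivity
      push_cast at *
      linarith
    · rw [Nat.succ_mul, Finset.sum_range_add]
      refine (abs_add_le _ _).trans ?_
      have := h m hm
      push_cast
      linarith

/-- If all late blocks of length `N` of a bounded sequence have average `ε`-close to `c`,
then the running averages are eventually `ε'`-close to `c`, for every `ε' > ε`. -/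
theorem eventually_abs_average_sub_le {a : ℕ → ℝ} {N : ℕ} (hN : 0 < N) {B c ε ε' : ℝ}
    (hB : ∀ i, |a i| ≤ B) (hε : 0 ≤ ε) (hε' : ε < ε')
    (h : ∀ᶠ k in atTop, |∑ i ∈ Finset.range N, a (k * N + i) - N * c| ≤ N * ε) :
    ∀ᶠ n : ℕ in atTop, |(∑ i ∈ Finset.range n, a i) / n - c| ≤ ε' := by
  obtain ⟨K, hK⟩ := eventually_atTop.1 h
  set b : ℕ → ℝ := fun i => a i - c with hb
  have hbB : ∀ i, |b i| ≤ B + |c| := fun i => (abs_sub _ _).trans (by gcongr; exact hB i)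
  have hB0 : 0 ≤ B + |c| := (abs_nonneg _).trans (hbB 0)
  have hblock := abs_sum_range_mul_le (a := b) (N := N) (K := K) hbB hε
    (fun k hk => by simpa [hb, Finset.sum_sub_distrib] using hK k hk)
  set C : ℝ := K * N * (B + |c|) + N * (B + |c|) with hC
  have key : ∀ n : ℕ, |∑ i ∈ Finset.range n, b i| ≤ C + n * ε := by
    intro n
    obtain ⟨m, r, hr, rfl⟩ : ∃ m r, r < N ∧ n = m * N + r :=
      ⟨n / N, n % N, Nat.mod_lt _ hN, (Nat.div_add_mod' n N).symm⟩
    rw [Finset.sum_range_add]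
    refine (abs_add_le _ _).trans ?_
    have h1 : |∑ i ∈ Finset.range r, b (m * N + i)| ≤ N * (B + |c|) :=
      (Finset.abs_sum_le_sum_abs _ _).trans
        ((Finset.sum_le_sum fun i _ => hbB _).trans (by
          simp only [Finset.sum_const, Finset.card_range, nsmul_eq_mul]
          gcongr))
    have h2 : 0 ≤ (r : ℝ) * ε := by positivity
    have := hblock m
    push_cast
    linarith
  obtain ⟨n₀, hn₀⟩ := exists_nat_gt (C / (ε' - ε))
  filter_upwards [eventually_ge_atTop (n₀ + 1)] with n hn
  have hnpos : (0 : ℝ) < n := by exact_mod_cast (by omega : 0 < n)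
  have e : (∑ i ∈ Finset.range n, a i) / n - c = (∑ i ∈ Finset.range n, b i) / n := by
    simp only [hb, Finset.sum_sub_distrib, Finset.sum_const, Finset.card_range, nsmul_eq_mul]
    field_simp
  rw [e, abs_div, abs_of_pos hnpos, div_le_iff₀ hnpos]
  have h1 : C / (ε' - ε) ≤ n := hn₀.le.trans (by exact_mod_cast (by omega : n₀ ≤ n))
  rw [div_le_iff₀ (by linarith)] at h1
  linarith [key n]

theorem exists_tendsto_of_forall_eventually_abs_sub_le {u : ℕ → ℝ}
    (h : ∀ ε > 0, ∃ c, ∀ᶠ n in atTop, |u n - c| ≤ ε) : ∃ l, Tendsto u atTop (𝓝 l) := by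
  refine cauchySeq_tendsto_of_complete (Metric.cauchySeq_iff'.2 fun ε hε => ?_)
  obtain ⟨c, hc⟩ := h (ε / 3) (by positivity)
  obtain ⟨n₀, hn₀⟩ := eventually_atTop.1 hc
  refine ⟨n₀, fun n hn => ?_⟩
  rw [Real.dist_eq]
  have h1 := abs_le.1 (hn₀ n hn)
  have h2 := abs_le.1 (hn₀ n₀ le_rfl)
  rw [abs_lt]
  constructor <;> linarith [h1.1, h1.2, h2.1, h2.2]

/-! ### Empirical measures -/

/-- The uniform distribution on the first `n` terms of a sequence. -/
noncomputable def empirical (y : ℕ → ℝ) (n : ℕ) : Measure ℝ :=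
  (n : ℝ≥0∞)⁻¹ • ∑ i ∈ Finset.range n, Measure.dirac (y i)

theorem isProbabilityMeasure_empirical (y : ℕ → ℝ) {n : ℕ} (hn : n ≠ 0) :
    IsProbabilityMeasure (empirical y n) := by
  constructor
  simp only [empirical, Measure.smul_apply, Measure.finsetSum_apply, measure_univ,
    Finset.sum_const, Finset.card_range, smul_eq_mul, nsmul_eq_mul, mul_one]
  exact ENNReal.inv_mul_cancel (by exact_mod_cast hn) (ENNReal.natCast_ne_top n)

theorem integral_empirical (y : ℕ → ℝ) (n : ℕ) (g : ℝ → ℝ) :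
    ∫ x, g x ∂(empirical y n) = (∑ i ∈ Finset.range n, g (y i)) / n := by
  rw [empirical, integral_smul_measure, integral_finsetSum_measure]
  · simp [div_eq_inv_mul]
  · intro i _
    exact integrable_dirac (by simp [enorm_lt_top])

theorem empirical_compl_eq_zero {y : ℕ → ℝ} {K : Set ℝ} (hK : MeasurableSet K)
    (hy : ∀ i, y i ∈ K) (n : ℕ) : empirical y n Kᶜ = 0 := by
  simp [empirical, Measure.smul_apply, Measure.finsetSum_apply, hK, hy]

/-- Empirical measures of a sequence in a compact set have a cluster point. -/
theorem exists_ultrafilter_tendsto_empirical {y : ℕ → ℝ} {K : Set ℝ} (hK : IsCompact K)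
    (hy : ∀ i, y i ∈ K) :
    ∃ (ν : Measure ℝ) (G : Ultrafilter ℕ), IsProbabilityMeasure ν ∧ ν Kᶜ = 0 ∧
      (G : Filter ℕ) ≤ atTop ∧
      ∀ g : ℝ → ℝ, Continuous g → (∃ C, ∀ x, |g x| ≤ C) →
        Tendsto (fun n => (∑ i ∈ Finset.range n, g (y i)) / (n : ℝ)) G (𝓝 (∫ x, g x ∂ν)) := by
  -- The index is shifted because `empirical y 0` is the zero measure.
  let P : ℕ → ProbabilityMeasure ℝ := fun n =>
    ⟨empirical y (n + 1), isProbabilityMeasure_empirical y n.succ_ne_zero⟩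
  -- Prokhorov compactness, with no mass allowed outside `K`.
  have hcomp := isCompact_setOfPred_probabilityMeasure_mass_eq_compl_isCompact_le
    (E := ℝ) (u := fun _ => 0) (K := fun _ => K) tendsto_const_nhds (fun _ => hK)
    (Or.inl inferInstance)
  let G₀ : Ultrafilter ℕ := Ultrafilter.of atTop
  have hG₀ : (G₀ : Filter ℕ) ≤ atTop := Ultrafilter.of_le _
  obtain ⟨ν, hν, hlim⟩ := hcomp.ultrafilter_le_nhds (G₀.map P) (by
    rw [le_principal_iff]
    refine Filter.mem_map.2 (Filter.univ_mem' fun n => ?_)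
    intro _
    have : (P n : Measure ℝ) Kᶜ = 0 := empirical_compl_eq_zero hK.measurableSet hy _
    simp [ProbabilityMeasure.coeFn_def, this])
  have hlim' : Tendsto P G₀ (𝓝 ν) := hlim
  rw [ProbabilityMeasure.tendsto_iff_forall_integral_tendsto] at hlim'
  refine ⟨ν, G₀.map (· + 1), inferInstance, ?_, ?_, ?_⟩
  · have := hν 0
    rw [nonpos_iff_eq_zero] at this
    rw [← ProbabilityMeasure.ennreal_coeFn_eq_coeFn_toMeasure, this]
    rfl
  · exact (Filter.map_mono hG₀).trans (tendsto_add_atTop_nat 1)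
  · rintro g hg ⟨C, hC⟩
    have := hlim' (BoundedContinuousFunction.ofNormedAddCommGroup g hg C hC)
    simp only [BoundedContinuousFunction.coe_ofNormedAddCommGroup] at this
    rw [Ultrafilter.coe_map, tendsto_map'_iff]
    refine this.congr fun n => ?_
    exact integral_empirical y (n + 1) g

/-- If the averages of every Lipschitz function along a sequence in a compact set converge, the
empirical measures converge weakly. -/
theorem exists_weaklyConverges_empirical {y : ℕ → ℝ} {K : Set ℝ} (hK : IsCompact K)
    (hy : ∀ i, y i ∈ K)
    (h : ∀ g : ℝ → ℝ, (∃ L, LipschitzWith L g) →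
      ∃ l, Tendsto (fun n : ℕ => (∑ i ∈ Finset.range n, g (y i)) / n) atTop (𝓝 l)) :
    ∃ ν : Measure ℝ, IsProbabilityMeasure ν ∧ ν Kᶜ = 0 ∧ WeaklyConverges (empirical y) ν := by
  obtain ⟨ν, G, hν, hνK, hG, hlim⟩ := exists_ultrafilter_tendsto_empirical hK hy
  refine ⟨ν, hν, hνK, fun g => ?_⟩
  let P : ℕ → ProbabilityMeasure ℝ := fun n =>
    ⟨empirical y (n + 1), isProbabilityMeasure_empirical y n.succ_ne_zero⟩
  let Q : ProbabilityMeasure ℝ := ⟨ν, hν⟩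
  have hP : Tendsto P atTop (𝓝 Q) := by
    rw [tendsto_iff_forall_lipschitz_integral_tendsto]
    rintro g ⟨C, hC⟩ ⟨L, hL⟩
    obtain ⟨l, hl⟩ := h g ⟨L, hL⟩
    have h2 := hlim g hL.continuous ⟨|g 0| + C, fun x => by
      have h1 := hC x 0
      rw [Real.dist_eq] at h1
      have h2 := abs_sub_abs_le_abs_sub (g x) (g 0)
      linarith⟩
    rw [tendsto_nhds_unique (hl.mono_left hG) h2] at hl
    exact ((tendsto_add_atTop_iff_nat 1).2 hl).congr fun n => (integral_empirical y (n + 1) g).symm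
  rw [ProbabilityMeasure.tendsto_iff_forall_integral_tendsto] at hP
  exact (tendsto_add_atTop_iff_nat 1).1 (hP g)

/-! ### Measures on the unit interval and periodic functions -/

theorem eq_map_fract {μ : Measure ℝ} (hμ : μ (Set.Ico 0 1)ᶜ = 0) : μ.map Int.fract = μ := by
  have : (Int.fract : ℝ → ℝ) =ᵐ[μ] id := by
    filter_upwards [mem_ae_iff.2 hμ] with x hx
    exact Int.fract_eq_self.2 hx
  rw [Measure.map_congr this, Measure.map_id]

/-- Probability measures on `[0, 1)` are determined by the integrals of the periodic Lipschitz
functions. -/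
theorem eq_of_forall_integral_periodic_eq {μ ν : Measure ℝ} [IsProbabilityMeasure μ]
    [IsProbabilityMeasure ν] (hμ : μ (Set.Ico 0 1)ᶜ = 0) (hν : ν (Set.Ico 0 1)ᶜ = 0)
    (h : ∀ g : ℝ → ℝ, Function.Periodic g 1 → (∃ L, LipschitzWith L g) →
      ∫ x, g x ∂μ = ∫ x, g x ∂ν) : μ = ν := by
  let c : ℝ → UnitAddCircle := fun x => (x : UnitAddCircle)
  have hc : Measurable c := AddCircle.measurable_mk'
  have hcL : LipschitzWith 1 c := by
    refine LipschitzWith.of_dist_le_mul fun x y => ?_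
    rw [dist_eq_norm, dist_eq_norm, NNReal.coe_one, one_mul]
    exact QuotientAddGroup.norm_mk_le_norm (S := AddSubgroup.zmultiples (1 : ℝ)) (m := x - y)
  have hP : ∀ ρ : Measure ℝ, IsProbabilityMeasure ρ → IsProbabilityMeasure (ρ.map c) :=
    fun ρ _ => Measure.isProbabilityMeasure_map hc.aemeasurable
  have hmap : μ.map c = ν.map c := by
    let P : ProbabilityMeasure UnitAddCircle := ⟨μ.map c, hP μ inferInstance⟩
    let Q : ProbabilityMeasure UnitAddCircle := ⟨ν.map c, hP ν inferInstance⟩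
    -- Weak convergence is tested on Lipschitz functions, so a constant sequence at `P` converges to
    -- `Q`; limits being unique, `P = Q`.
    have hlim : Tendsto (fun _ : ℕ => P) atTop (𝓝 Q) := by
      rw [tendsto_iff_forall_lipschitz_integral_tendsto]
      rintro g - ⟨L, hL⟩
      have : ∫ x, g x ∂(P : Measure UnitAddCircle) = ∫ x, g x ∂(Q : Measure UnitAddCircle) := by
        change ∫ x, g x ∂(μ.map c) = ∫ x, g x ∂(ν.map c)
        rw [integral_map hc.aemeasurable hL.continuous.aestronglyMeasurable,
          integral_map hc.aemeasurable hL.continuous.aestronglyMeasurable]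
        exact h (g ∘ c) (fun x => by simp [c]) ⟨_, hL.comp hcL⟩
      rw [this]
      exact tendsto_const_nhds
    exact congrArg ProbabilityMeasure.toMeasure (tendsto_nhds_unique tendsto_const_nhds hlim)
  let r : UnitAddCircle → ℝ := fun x => (AddCircle.measurableEquivIco 1 0 x : ℝ)
  have hr : Measurable r := measurable_subtype_coe.comp (AddCircle.measurableEquivIco 1 0).measurable
  have hrc : r ∘ c = Int.fract := by
    ext x
    simp only [r, c, Function.comp_apply, AddCircle.measurableEquivIco]
    exact (AddCircle.coe_equivIco_mk_apply (p := (1 : ℝ)) x).trans (by simp)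
  rw [← eq_map_fract hμ, ← eq_map_fract hν, ← hrc, ← Measure.map_map hr hc, hmap,
    Measure.map_map hr hc]

/-! ### Birkhoff averages over lifts of degree one circle maps -/

open CircleDeg1Lift in
theorem abs_map_sub_sub_translationNumber_le (f : CircleDeg1Lift) (x : ℝ) :
    |f x - x - translationNumber f| ≤ 1 := by
  rw [abs_le]
  constructor
  · by_contra! hlt
    have h1 : f x < x + (translationNumber f - 1) := by linarith
    have h2 := f.translationNumber_le_ceil_sub x
    have h3 := Int.ceil_lt_add_one (f x - x)
    linarith
  · linarith [f.map_lt_add_translationNumber_add_one x]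

/-- The one-step bound `1` holds for every lift, so applying it to `f ^ n` gives a deviation from
linear growth that does not grow with `n`. -/
theorem abs_iterate_sub_sub_le (f : CircleDeg1Lift) (n : ℕ) (x : ℝ) :
    |f^[n] x - x - n * f.translationNumber| ≤ 1 := by
  have := abs_map_sub_sub_translationNumber_le (f ^ n) x
  rwa [CircleDeg1Lift.translationNumber_pow, CircleDeg1Lift.coe_pow] at this

theorem abs_map_sub_map_sub_le (c : CircleDeg1Lift) (x y : ℝ) :
    |c y - c x - (y - x)| ≤ 1 := by
  have key : ∀ x y, c y - c x - (y - x) ≤ 1 := fun x y => by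
    have h1 : c y ≤ c (x + ⌈y - x⌉) := c.monotone (by linarith [Int.le_ceil (y - x)])
    rw [c.map_add_int] at h1
    linarith [Int.ceil_lt_add_one (y - x)]
  rw [abs_le]
  exact ⟨by linarith [key y x], key x y⟩

theorem iterate_sub_int (f : CircleDeg1Lift) (n : ℕ) (x : ℝ) (m : ℤ) :
    f^[n] (x - m) = f^[n] x - m := by
  rw [← CircleDeg1Lift.coe_pow, CircleDeg1Lift.map_sub_int]

/-- Moving the starting point along the orbit changes the Birkhoff sums of a degree one
monotone function by the expected drift, up to a bounded error. -/
theorem abs_sum_iterate_shift_sub_le (f c : CircleDeg1Lift) (t : ℝ) (N k : ℕ) (m : ℤ) :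
    |∑ i ∈ Finset.range N, c (f^[i] (f^[k] t - m)) - ∑ i ∈ Finset.range N, c (f^[i] t)
      - N * (k * f.translationNumber - m)| ≤ 2 * k := by
  have h1 : ∑ i ∈ Finset.range N, c (f^[i] (f^[k] t - m)) =
      ∑ i ∈ Finset.range N, c (f^[k + i] t) - N * m := by
    rw [eq_sub_iff_add_eq]
    have : (N : ℝ) * m = ∑ _i ∈ Finset.range N, (m : ℝ) := by simp
    rw [this, ← Finset.sum_add_distrib]
    refine Finset.sum_congr rfl fun i _ => ?_
    rw [iterate_sub_int, CircleDeg1Lift.map_sub_int, add_comm k i, Function.iterate_add_apply]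
    ring
  -- The two windows overlap except for `k` terms at each end; each pair of end terms is `N` steps
  -- apart and contributes its drift `N * ρ` up to an error of 2.
  have h2 : ∑ i ∈ Finset.range N, c (f^[k + i] t) - ∑ i ∈ Finset.range N, c (f^[i] t)
      = ∑ i ∈ Finset.range k, (c (f^[N + i] t) - c (f^[i] t)) := by
    have e1 := Finset.sum_range_add (fun i => c (f^[i] t)) k N
    have e2 := Finset.sum_range_add (fun i => c (f^[i] t)) N k
    rw [Finset.sum_sub_distrib]
    rw [add_comm k N] at e1
    linarith
  have h3 : ∑ i ∈ Finset.range N, c (f^[i] (f^[k] t - m)) - ∑ i ∈ Finset.range N, c (f^[i] t)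
      - N * (k * f.translationNumber - m) =
      ∑ i ∈ Finset.range k, (c (f^[N + i] t) - c (f^[i] t) - N * f.translationNumber) := by
    rw [Finset.sum_sub_distrib, ← h2, h1]
    simp only [Finset.sum_const, Finset.card_range, nsmul_eq_mul]
    ring
  rw [h3]
  refine (Finset.abs_sum_le_sum_abs _ _).trans ((Finset.sum_le_sum
    (g := fun _ => (2 : ℝ)) fun i _ => ?_).trans (by simp [mul_comm]))
  have a1 := abs_le.1 (abs_map_sub_map_sub_le c (f^[i] t) (f^[N + i] t))
  have a2 := abs_le.1 (abs_iterate_sub_sub_le f N (f^[i] t))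
  rw [← Function.iterate_add_apply] at a2
  rw [abs_le]
  constructor <;> linarith [a1.1, a1.2, a2.1, a2.2]

theorem exists_nat_mul_sub_int_pos_lt {ρ : ℝ} (hρ : Irrational ρ) {δ : ℝ} (hδ : 0 < δ) :
    ∃ (q : ℕ) (p : ℤ), 0 < q * ρ - p ∧ q * ρ - p < δ := by
  obtain ⟨n, hn⟩ := exists_nat_one_div_lt hδ
  obtain ⟨j, k, hk, -, hjk⟩ := Real.exists_int_int_abs_mul_sub_le ρ n.succ_pos
  lift k to ℕ using hk.le
  have hk' : k ≠ 0 := by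
    rintro rfl
    simp at hk
  have hjk' : |(k : ℝ) * ρ - j| < δ := by
    refine (hjk.trans ?_).trans_lt hn
    push_cast
    gcongr
    linarith
  have hirr : Irrational ((k : ℝ) * ρ - j) := (hρ.natCast_mul hk').sub_intCast j
  rcases lt_or_gt_of_ne hirr.ne_zero with hneg | hpos
  -- Dirichlet's approximation may have the wrong sign. With `m = ⌊1 / α⌋`, the remainder `1 - m *
  -- α` lies in `(0, α)`, strictly above zero by irrationality.
  · set α : ℝ := j - k * ρ with hα
    have hα0 : 0 < α := by linarith
    have hαδ : α < δ := by rw [abs_lt] at hjk'; linarith [hjk'.1]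
    have hαirr : Irrational α := by
      have := hirr.neg
      rwa [neg_sub] at this
    set m : ℤ := ⌊α⁻¹⌋ with hm
    have hm0 : 0 ≤ m := Int.floor_nonneg.2 (inv_nonneg.2 hα0.le)
    have h1 : (m : ℝ) < α⁻¹ :=
      lt_of_le_of_ne (Int.floor_le _) (fun h => hαirr.inv.ne_int m h.symm)
    have h2 : α⁻¹ < m + 1 := Int.lt_floor_add_one _
    have h3 : (m : ℝ) * α < 1 := by
      have := mul_lt_mul_of_pos_right h1 hα0
      rwa [inv_mul_cancel₀ hα0.ne'] at this
    have h4 : 1 < (m + 1) * α := by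
      have := mul_lt_mul_of_pos_right h2 hα0
      rwa [inv_mul_cancel₀ hα0.ne'] at this
    lift m to ℕ using hm0 with m'
    refine ⟨m' * k, m' * j - 1, ?_, ?_⟩ <;> push_cast at * <;> rw [hα] at * <;> linarith
  · exact ⟨k, j, hpos, (abs_lt.1 hjk').2⟩

/-- For an irrational translation number, Birkhoff sums of `c - id` have small oscillation,
uniformly in the degree one monotone map `c`. -/
theorem exists_oscillation_bound {f : CircleDeg1Lift} (hf : Irrational f.translationNumber)
    {δ : ℝ} (hδ : 0 < δ) : ∃ C : ℝ, ∀ (c : CircleDeg1Lift) (N : ℕ) (t s : ℝ),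
      |∑ i ∈ Finset.range N, (c (f^[i] s) - f^[i] s)
        - ∑ i ∈ Finset.range N, (c (f^[i] t) - f^[i] t)| ≤ N * δ + C := by
  obtain ⟨q, p, hpos, hlt⟩ := exists_nat_mul_sub_int_pos_lt hf hδ
  set α : ℝ := q * f.translationNumber - p with hα
  obtain ⟨J, hJ⟩ := exists_nat_gt (1 / α)
  rw [div_lt_iff₀ hpos] at hJ
  refine ⟨4 * (J * q), fun c N t s => ?_⟩
  wlog hs : t ≤ s ∧ s < t + 1 generalizing s with H
  · have h := H (s - ⌊s - t⌋)
      ⟨by linarith [Int.floor_le (s - t)], by linarith [Int.lt_floor_add_one (s - t)]⟩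
    simp only [iterate_sub_int, CircleDeg1Lift.map_sub_int, sub_sub_sub_cancel_right] at h
    exact h
  have hend : s < f^[J * q] t - ((J * p : ℤ) : ℝ) := by
    have h := (f ^ (J * q)).lt_map_of_int_lt_translationNumber (n := J * p + 1) (by
      rw [CircleDeg1Lift.translationNumber_pow]
      push_cast
      -- `J * α > 1`, so `J` shifts carry `t` beyond `t + 1`, hence beyond `s`.
      rw [hα] at hJ
      linarith) t
    rw [CircleDeg1Lift.coe_pow] at h
    push_cast at h ⊢
    linarith [hs.2]
  classical
  -- The first shift of `t` to overshoot `s`, and the one before it, trap `s`.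
  have hex : ∃ j : ℕ, s < f^[j * q] t - ((j * p : ℤ) : ℝ) := ⟨J, hend⟩
  obtain ⟨j, hj⟩ : ∃ j, Nat.find hex = j + 1 := by
    refine Nat.exists_eq_succ_of_ne_zero fun h0 => ?_
    have := Nat.find_spec hex
    rw [h0] at this
    simp at this
    linarith [hs.1]
  have hupper := Nat.find_spec hex
  rw [hj] at hupper
  have hlower := not_lt.1 (Nat.find_min hex (m := j) (by omega))
  have hjJ : j + 1 ≤ J := hj ▸ Nat.find_min' hex hend
  have hjJ' : ((j : ℝ) + 1) * q ≤ J * q := by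
    gcongr
    exact_mod_cast hjJ
  have key : ∀ c : CircleDeg1Lift,
      N * (j * α) - 2 * (J * q) ≤
        ∑ i ∈ Finset.range N, c (f^[i] s) - ∑ i ∈ Finset.range N, c (f^[i] t) ∧
      ∑ i ∈ Finset.range N, c (f^[i] s) - ∑ i ∈ Finset.range N, c (f^[i] t) ≤
        N * ((j + 1) * α) + 2 * (J * q) := by
    intro c
    have b1 := (abs_le.1 (abs_sum_iterate_shift_sub_le f c t N (j * q) (j * p))).1
    have b2 := (abs_le.1 (abs_sum_iterate_shift_sub_le f c t N ((j + 1) * q)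
      ((j + 1 : ℕ) * p))).2
    have m1 : ∑ i ∈ Finset.range N, c (f^[i] (f^[j * q] t - ((j * p : ℤ) : ℝ))) ≤
        ∑ i ∈ Finset.range N, c (f^[i] s) :=
      Finset.sum_le_sum fun i _ => c.monotone (f.monotone.iterate i hlower)
    have m2 : ∑ i ∈ Finset.range N, c (f^[i] s) ≤ ∑ i ∈ Finset.range N,
        c (f^[i] (f^[(j + 1) * q] t - (((j + 1 : ℕ) * p : ℤ) : ℝ))) :=
      Finset.sum_le_sum fun i _ => c.monotone (f.monotone.iterate i hupper.le)
    have q0 : (0 : ℝ) ≤ q := by positivity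
    rw [hα]
    push_cast at b1 b2 m1 m2 ⊢
    constructor <;> nlinarith
  have k1 := key c
  -- The same unknown `j` occurs for `c` and for the identity; subtracting removes it and leaves one
  -- step `N * α`.
  have k2 := key 1
  simp only [CircleDeg1Lift.coe_one, id_eq] at k2
  have hN : (N : ℝ) * α ≤ N * δ := by gcongr
  simp only [Finset.sum_sub_distrib]
  rw [abs_le]
  constructor <;> linarith [k1.1, k1.2, k2.1, k2.2]

/-- For an irrational translation number, Birkhoff averages of periodic Lipschitz functions
have small oscillation, uniformly among functions with the same Lipschitz constant. -/
theorem exists_abs_birkhoff_sub_le {f : CircleDeg1Lift} (hf : Irrational f.translationNumber)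
    {ε : ℝ} (hε : 0 < ε) : ∃ N : ℕ, 0 < N ∧ ∀ (L : ℝ) (h : ℝ → ℝ), 0 < L →
      Function.Periodic h 1 → (∀ x y, |h x - h y| ≤ L * |x - y|) → ∀ t s : ℝ,
      |∑ i ∈ Finset.range N, h (f^[i] s) - ∑ i ∈ Finset.range N, h (f^[i] t)|
        ≤ N * (L * ε) := by
  obtain ⟨C, hC⟩ := exists_oscillation_bound hf (half_pos hε)
  obtain ⟨n, hn⟩ := exists_nat_gt (C / (ε / 2))
  rw [div_lt_iff₀ (half_pos hε)] at hn
  refine ⟨n + 1, n.succ_pos, fun L h hL hper hlip t s => ?_⟩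
  let c : CircleDeg1Lift :=
    { toFun := fun x => x + h x / L
      monotone' := fun x y hxy => by
        have h1 := (abs_le.1 (hlip y x)).1
        rw [abs_of_nonneg (sub_nonneg.2 hxy)] at h1
        have h2 : (h x - h y) / L ≤ y - x := by
          rw [div_le_iff₀ hL]
          linarith
        rw [sub_div] at h2
        change x + h x / L ≤ y + h y / L
        linarith
      map_add_one' := fun x => by
        rw [hper x]
        ring }
  have hc : ∀ x, c x - x = h x / L := fun x => by
    change x + h x / L - x = _
    ring
  have key := hC c (n + 1) t s
  simp only [hc, ← Finset.sum_div] at key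
  rw [← sub_div, abs_div, abs_of_pos hL, div_le_iff₀ hL] at key
  refine key.trans ?_
  push_cast
  nlinarith

theorem periodic_map_fract {h : ℝ → ℝ} (hper : Function.Periodic h 1) (x : ℝ) :
    h (Int.fract x) = h x := by
  have := hper.sub_int_mul_eq (x := x) ⌊x⌋
  rwa [mul_one] at this

theorem abs_le_of_periodic {h : ℝ → ℝ} {L : ℝ} (hL : 0 ≤ L) (hper : Function.Periodic h 1)
    (hlip : ∀ x y, |h x - h y| ≤ L * |x - y|) (x : ℝ) : |h x| ≤ |h 0| + L := by
  have h2 := hlip (Int.fract x) 0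
  rw [periodic_map_fract hper, sub_zero, abs_of_nonneg (Int.fract_nonneg x)] at h2
  have h3 : L * Int.fract x ≤ L * 1 := by
    gcongr
    exact (Int.fract_lt_one x).le
  have h4 := abs_sub_abs_le_abs_sub (h x) (h 0)
  linarith

theorem continuous_of_abs_sub_le {h : ℝ → ℝ} {L : ℝ} (hL : 0 ≤ L)
    (hlip : ∀ x y, |h x - h y| ≤ L * |x - y|) : Continuous h :=
  (LipschitzWith.of_dist_le_mul (K := ⟨L, hL⟩) fun x y => hlip x y).continuous

/-- The map `x ↦ f^[q] x - p` is monotone, so its orbits are monotone sequences; having no drift,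
they stay within 1 of their start and converge. -/
theorem exists_tendsto_iterate_of_rational {f : CircleDeg1Lift} {q : ℕ} {p : ℤ}
    (hq : q * f.translationNumber = p) (t : ℝ) :
    ∃ z, Tendsto (fun k : ℕ => f^[k * q] t - ((k * p : ℤ) : ℝ)) atTop (𝓝 z) := by
  set u : ℕ → ℝ := fun k => f^[k * q] t - ((k * p : ℤ) : ℝ) with hu
  have hstep : ∀ k, u (k + 1) = f^[q] (u k) - p := fun k => by
    simp only [hu]
    rw [iterate_sub_int, ← Function.iterate_add_apply, add_mul, one_mul, add_comm q]
    push_cast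
    ring
  have hbd : ∀ k, |u k - t| ≤ 1 := fun k => by
    have := abs_iterate_sub_sub_le f (k * q) t
    have e : f^[k * q] t - t - ((k * q : ℕ) : ℝ) * f.translationNumber = u k - t := by
      simp only [hu]
      push_cast
      rw [mul_assoc, hq]
      ring
    rwa [e] at this
  have hmono : Monotone fun x => f^[q] x - p := fun x y hxy => by
    have := f.monotone.iterate q hxy
    simpa using this
  rcases le_total (u 0) (u 1) with h01 | h01
  · have hu' : Monotone u := monotone_nat_of_le_succ fun k => by
      induction k with
      | zero => exact h01
      | succ k ih =>
        rw [hstep k, hstep (k + 1)]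
        exact hmono ih
    exact ⟨_, tendsto_atTop_ciSup hu' ⟨t + 1, by
      rintro _ ⟨k, rfl⟩
      linarith [(abs_le.1 (hbd k)).2]⟩⟩
  · have hu' : Antitone u := antitone_nat_of_succ_le fun k => by
      induction k with
      | zero => exact h01
      | succ k ih =>
        rw [hstep k, hstep (k + 1)]
        exact hmono ih
    exact ⟨_, tendsto_atTop_ciInf hu' ⟨t - 1, by
      rintro _ ⟨k, rfl⟩
      linarith [(abs_le.1 (hbd k)).1]⟩⟩

/-- Birkhoff averages of a periodic Lipschitz function over a continuous lift converge at every
point. -/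
theorem exists_tendsto_birkhoff {f : CircleDeg1Lift} (hf : Continuous f) {h : ℝ → ℝ} {L : ℝ}
    (hL : 0 < L) (hper : Function.Periodic h 1) (hlip : ∀ x y, |h x - h y| ≤ L * |x - y|)
    (t : ℝ) : ∃ l, Tendsto (fun n : ℕ => (∑ i ∈ Finset.range n, h (f^[i] t)) / n)
      atTop (𝓝 l) := by
  have hbd : ∀ i, |h (f^[i] t)| ≤ |h 0| + L := fun i => abs_le_of_periodic hL.le hper hlip _
  refine exists_tendsto_of_forall_eventually_abs_sub_le fun ε hε => ?_
  by_cases hirr : Irrational f.translationNumber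
  · obtain ⟨N, hN, hosc⟩ := exists_abs_birkhoff_sub_le hirr (ε := ε / (2 * L)) (by positivity)
    have hN' : (N : ℝ) ≠ 0 := by exact_mod_cast hN.ne'
    refine ⟨(∑ i ∈ Finset.range N, h (f^[i] t)) / N,
      eventually_abs_average_sub_le hN hbd (half_pos hε).le (half_lt_self hε)
        (Eventually.of_forall fun k => ?_)⟩
    have := hosc L h hL hper hlip t (f^[k * N] t)
    simp only [← Function.iterate_add_apply] at this
    simp only [add_comm (k * N)]
    rw [mul_div_cancel₀ _ hN']
    refine this.trans (le_of_eq ?_)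
    field_simp
  · obtain ⟨r, hr⟩ := not_not.1 hirr
    have hq : (r.den : ℝ) * f.translationNumber = (r.num : ℤ) := by
      rw [← hr]
      exact_mod_cast Rat.den_mul_eq_num r
    obtain ⟨z, hz⟩ := exists_tendsto_iterate_of_rational hq t
    have hcont := continuous_of_abs_sub_le hL.le hlip
    have hsum : Continuous fun x => ∑ i ∈ Finset.range r.den, h (f^[i] x) :=
      continuous_finsetSum _ fun i _ => hcont.comp (hf.iterate i)
    have hlim := (hsum.tendsto z).comp hz
    -- By periodicity, the `k`-th block sum is one continuous function evaluated along a convergent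
    -- sequence.
    have hblock : ∀ k : ℕ, ∑ i ∈ Finset.range r.den, h (f^[k * r.den + i] t) =
        ∑ i ∈ Finset.range r.den, h (f^[i] (f^[k * r.den] t - ((k * r.num : ℤ) : ℝ))) := fun k => by
      refine Finset.sum_congr rfl fun i _ => ?_
      rw [iterate_sub_int, ← Function.iterate_add_apply, add_comm i]
      have := hper.sub_int_mul_eq (x := f^[k * r.den + i] t) (k * r.num)
      rw [mul_one] at this
      exact this.symm
    have hd : (0 : ℝ) < r.den := by exact_mod_cast r.den_pos
    refine ⟨(∑ i ∈ Finset.range r.den, h (f^[i] z)) / r.den,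
      eventually_abs_average_sub_le r.den_pos hbd (half_pos hε).le (half_lt_self hε) ?_⟩
    filter_upwards [Metric.tendsto_nhds.1 hlim (r.den * (ε / 2)) (by positivity)] with k hk
    rw [hblock, mul_div_cancel₀ _ hd.ne']
    exact hk.le

/-! ### Essentially bounded periodic functions -/

theorem ae_comp_add_right {p : ℝ → Prop} (h : ∀ᵐ t : ℝ, p t) (a : ℝ) : ∀ᵐ t : ℝ, p (t + a) :=
  (measurePreserving_add_right volume a).quasiMeasurePreserving.ae h

theorem OnePeriodic.ae_add_int {f : ℝ → ℝ} (hf : OnePeriodic f) :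
    ∀ᵐ t : ℝ, ∀ n : ℤ, f (t + n) = f t := by
  have hnat : ∀ n : ℕ, ∀ᵐ t : ℝ, f (t + n) = f t := fun n => by
    induction n with
    | zero => simp
    | succ n ih =>
      filter_upwards [ih, ae_comp_add_right hf n] with t h1 h2
      push_cast
      rw [← add_assoc, h2, h1]
  refine ae_all_iff.2 fun n => ?_
  obtain ⟨k, rfl | rfl⟩ := n.eq_nat_or_neg
  · exact_mod_cast hnat k
  · filter_upwards [ae_comp_add_right (hnat k) (-k)] with t ht
    rw [neg_add_cancel_right] at ht
    push_cast
    exact ht.symm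

theorem OnePeriodic.sub {f g : ℝ → ℝ} (hf : OnePeriodic f) (hg : OnePeriodic g) :
    OnePeriodic (fun t => f t - g t) := by
  filter_upwards [hf, hg] with t h1 h2
  rw [h1, h2]

/-- `[-1, 1]` contains a full period, so the first seminorm of the metric already controls periodic
functions on the whole line. -/
theorem OnePeriodic.ae_abs_le {f : ℝ → ℝ} (hf : OnePeriodic f) {M : ℝ}
    (h : ∀ᵐ t ∂(volume.restrict (Set.Icc (-1 : ℝ) 1)), |f t| ≤ M) : ∀ᵐ t : ℝ, |f t| ≤ M := by
  rw [ae_restrict_iff' measurableSet_Icc] at h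
  have h' : ∀ᵐ t : ℝ, ∀ n : ℤ, t + n ∈ Set.Icc (-1 : ℝ) 1 → |f (t + n)| ≤ M :=
    ae_all_iff.2 fun n => ae_comp_add_right h n
  filter_upwards [h', hf.ae_add_int] with t h1 h2
  have := h1 (-⌊t⌋) (by
    push_cast
    constructor <;> linarith [Int.floor_le t, Int.lt_floor_add_one t])
  rwa [h2] at this

theorem ae_abs_le_of_memLp {f : ℝ → ℝ} {μ : Measure ℝ} (hf : MemLp f ∞ μ) :
    ∀ᵐ t ∂μ, |f t| ≤ (eLpNorm f ∞ μ).toReal := by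
  rw [eLpNorm_exponent_top]
  have hfin : eLpNormEssSup f μ ≠ ∞ := by
    have := hf.2
    rw [eLpNorm_exponent_top] at this
    exact this.ne
  filter_upwards [ae_le_eLpNormEssSup (f := f) (μ := μ)] with t ht
  have := ENNReal.toReal_mono hfin ht
  simpa using this

theorem MemLInftyLoc.exists_ae_abs_le {f : ℝ → ℝ} (hf : MemLInftyLoc f) (hper : OnePeriodic f) :
    ∃ M, ∀ᵐ t : ℝ, |f t| ≤ M :=
  ⟨_, hper.ae_abs_le (ae_abs_le_of_memLp (hf _ isCompact_Icc))⟩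

theorem ae_abs_sub_le_of_supDistOn_le {f g : ℝ → ℝ} (hf : MemLInftyLoc f) (hg : MemLInftyLoc g)
    (hfper : OnePeriodic f) (hgper : OnePeriodic g) {η : ℝ} (h : supDistOn 1 f g ≤ η) :
    ∀ᵐ t : ℝ, |f t - g t| ≤ η := by
  refine (hfper.sub hgper).ae_abs_le ?_
  have := ae_abs_le_of_memLp ((hf (Set.Icc (-1) 1) isCompact_Icc).sub (hg _ isCompact_Icc))
  filter_upwards [this] with t ht
  refine ht.trans ?_
  rw [supDistOn] at h
  norm_num at h
  exact h

theorem MemLInftyLoc.intervalIntegrable {f : ℝ → ℝ} (hf : MemLInftyLoc f) (a b : ℝ) :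
    IntervalIntegrable f volume a b := by
  rw [intervalIntegrable_iff]
  have : IsFiniteMeasure (volume.restrict (Set.uIcc a b)) :=
    ⟨by rw [Measure.restrict_apply_univ]; exact isCompact_uIcc.measure_lt_top⟩
  have h1 : IntegrableOn f (Set.uIcc a b) :=
    (hf (Set.uIcc a b) isCompact_uIcc).integrable (by simp)
  exact h1.mono_set Set.uIoc_subset_uIcc

theorem supDistOn_lt_of_distLInftyLoc_lt {f g : ℝ → ℝ} {η : ℝ} (hη : 0 < η)
    (h : distLInftyLoc f g < 1 / 2 * (η / (1 + η))) : supDistOn 1 f g < η := by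
  have h0 : ∀ k, 0 ≤ supDistOn k f g := fun k => ENNReal.toReal_nonneg
  set F : ℕ → ℝ := fun k =>
    (1 / 2 : ℝ) ^ (k + 1) * (supDistOn (k + 1) f g / (1 + supDistOn (k + 1) f g)) with hF
  have hF0 : ∀ k, 0 ≤ F k := fun k => by
    have := h0 (k + 1)
    positivity
  have hsum : Summable F := by
    refine Summable.of_nonneg_of_le hF0 (fun k => ?_)
      ((summable_nat_add_iff 1).2 (summable_geometric_of_lt_one (r := (1 / 2 : ℝ))
        (by norm_num) (by norm_num)))
    have := h0 (k + 1)
    have h1 : supDistOn (k + 1) f g / (1 + supDistOn (k + 1) f g) ≤ 1 := by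
      rw [div_le_one (by linarith)]
      linarith
    exact mul_le_of_le_one_right (by positivity) h1
  have h1 : F 0 ≤ distLInftyLoc f g := hsum.le_tsum 0 fun k _ => hF0 k
  have h2 := h1.trans_lt h
  simp only [hF, zero_add, pow_one] at h2
  have h3 := lt_of_mul_lt_mul_left h2 (by norm_num)
  have := h0 1
  rw [div_lt_div_iff₀ (by linarith) (by linarith)] at h3
  linarith

/-! ### The firing map -/

/-- The integral in the definition of the firing map. -/
noncomputable def drive (σ : ℝ) (f : ℝ → ℝ) (a b : ℝ) : ℝ :=
  ∫ u in a..b, (f u - σ) * Real.exp (σ * u)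

section drive

variable {σ ς M : ℝ} {f g : ℝ → ℝ}

theorem intervalIntegrable_drive (σ : ℝ) (hf : MemLInftyLoc f) (a b : ℝ) :
    IntervalIntegrable (fun u => (f u - σ) * Real.exp (σ * u)) volume a b :=
  ((hf.intervalIntegrable a b).sub intervalIntegrable_const).mul_continuousOn
    (by fun_prop)

theorem drive_add (hf : MemLInftyLoc f) (a b c : ℝ) :
    drive σ f a b + drive σ f b c = drive σ f a c :=
  intervalIntegral.integral_add_adjacent_intervals (intervalIntegrable_drive σ hf a b)
    (intervalIntegrable_drive σ hf b c)

theorem drive_symm (σ : ℝ) (f : ℝ → ℝ) (a b : ℝ) : drive σ f b a = -drive σ f a b :=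
  intervalIntegral.integral_symm a b

theorem le_drive (hσ : 0 ≤ σ) (hς : 0 ≤ ς) (hf : MemLInftyLoc f)
    (hpos : ∀ᵐ t : ℝ, ς ≤ f t - σ) {a b : ℝ} (hab : a ≤ b) :
    ς * Real.exp (σ * a) * (b - a) ≤ drive σ f a b := by
  have h : ∫ _u in a..b, ς * Real.exp (σ * a) ≤ drive σ f a b := by
    refine intervalIntegral.integral_mono_ae_restrict hab intervalIntegrable_const
      (intervalIntegrable_drive σ hf a b) ?_
    filter_upwards [ae_restrict_mem measurableSet_Icc, ae_restrict_of_ae hpos] with u hu hfu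
    have : Real.exp (σ * a) ≤ Real.exp (σ * u) :=
      Real.exp_le_exp.2 (mul_le_mul_of_nonneg_left hu.1 hσ)
    gcongr
    exact hς.trans hfu
  rw [intervalIntegral.integral_const, smul_eq_mul] at h
  linarith

theorem drive_le (hσ : 0 ≤ σ) (hM : 0 ≤ M) (hf : MemLInftyLoc f)
    (hle : ∀ᵐ t : ℝ, f t - σ ≤ M) {a b : ℝ} (hab : a ≤ b) :
    drive σ f a b ≤ M * Real.exp (σ * b) * (b - a) := by
  have h : drive σ f a b ≤ ∫ _u in a..b, M * Real.exp (σ * b) := by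
    refine intervalIntegral.integral_mono_ae_restrict hab
      (intervalIntegrable_drive σ hf a b) intervalIntegrable_const ?_
    filter_upwards [ae_restrict_mem measurableSet_Icc, ae_restrict_of_ae hle] with u hu hfu
    have : Real.exp (σ * u) ≤ Real.exp (σ * b) :=
      Real.exp_le_exp.2 (mul_le_mul_of_nonneg_left hu.2 hσ)
    gcongr
  rw [intervalIntegral.integral_const, smul_eq_mul] at h
  linarith

theorem abs_drive_sub_drive_le (hσ : 0 ≤ σ) (hf : MemLInftyLoc f) (hg : MemLInftyLoc g) {η : ℝ}
    (h : ∀ᵐ t : ℝ, |f t - g t| ≤ η) {a b : ℝ} (hab : a ≤ b) :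
    |drive σ f a b - drive σ g a b| ≤ η * Real.exp (σ * b) * (b - a) := by
  rw [drive, drive, ← intervalIntegral.integral_sub (intervalIntegrable_drive σ hf a b)
    (intervalIntegrable_drive σ hg a b)]
  have := intervalIntegral.norm_integral_le_of_norm_le_const_ae (a := a) (b := b)
    (f := fun u => (f u - σ) * Real.exp (σ * u) - (g u - σ) * Real.exp (σ * u))
    (C := η * Real.exp (σ * b)) (by
      filter_upwards [h] with u hu hmem
      rw [Set.uIoc_of_le hab] at hmem
      rw [← sub_mul, sub_sub_sub_cancel_right, norm_mul, Real.norm_eq_abs, Real.norm_eq_abs,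
        Real.abs_exp]
      have h0 : 0 ≤ η := (abs_nonneg _).trans hu
      have : Real.exp (σ * u) ≤ Real.exp (σ * b) :=
        Real.exp_le_exp.2 (mul_le_mul_of_nonneg_left hmem.2 hσ)
      gcongr)
  rwa [abs_of_nonneg (sub_nonneg.2 hab)] at this

theorem drive_add_one (hper : OnePeriodic f) (a b : ℝ) :
    drive σ f (a + 1) (b + 1) = Real.exp σ * drive σ f a b := by
  rw [drive, drive, ← intervalIntegral.integral_comp_add_right, ← intervalIntegral.integral_const_mul]
  refine intervalIntegral.integral_congr_ae ?_
  filter_upwards [hper] with u hu _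
  rw [hu, mul_add, mul_one, Real.exp_add]
  ring

theorem drive_lt (hσ : 0 ≤ σ) (hς : 0 < ς) (hf : MemLInftyLoc f)
    (hpos : ∀ᵐ t : ℝ, ς ≤ f t - σ) {a b c : ℝ} (hbc : b < c) :
    drive σ f a b < drive σ f a c := by
  rw [← drive_add hf a b c]
  have h1 := le_drive hσ hς.le hf hpos hbc.le
  have h2 : 0 < ς * Real.exp (σ * b) * (c - b) :=
    mul_pos (mul_pos hς (Real.exp_pos _)) (sub_pos.2 hbc)
  linarith

/-- The firing map is characterized by the threshold equation. -/
theorem firingMap_spec (hσ : 0 ≤ σ) (hς : 0 < ς) (hf : MemLInftyLoc f)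
    (hpos : ∀ᵐ t : ℝ, ς ≤ f t - σ) (t : ℝ) :
    t < firingMap σ f t ∧ firingMap σ f t ≤ t + 1 / ς ∧
      drive σ f t (firingMap σ f t) = Real.exp (σ * t) := by
  have hcont : Continuous (drive σ f t) :=
    intervalIntegral.continuous_primitive (intervalIntegrable_drive σ hf) t
  have hE := Real.exp_pos (σ * t)
  have hle : t ≤ t + 1 / ς := by
    have : 0 < 1 / ς := by positivity
    linarith
  have h1 : Real.exp (σ * t) ≤ drive σ f t (t + 1 / ς) := by
    refine le_trans (le_of_eq ?_) (le_drive hσ hς.le hf hpos hle)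
    field_simp
    ring
  have h0 : drive σ f t t = 0 := intervalIntegral.integral_same
  obtain ⟨s, hs, hseq⟩ := intermediate_value_Icc hle hcont.continuousOn
    (show Real.exp (σ * t) ∈ Set.Icc (drive σ f t t) (drive σ f t (t + 1 / ς)) from
      ⟨by rw [h0]; exact hE.le, h1⟩)
  have hmono : StrictMono (drive σ f t) := fun a b hab => drive_lt hσ hς hf hpos hab
  have hts : t < s := hmono.lt_iff_lt.1 (by rw [h0, hseq]; exact hE)
  have hset : {s : ℝ | t < s ∧ Real.exp (σ * t) ≤ ∫ u in t..s, (f u - σ) * Real.exp (σ * u)}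
      = Set.Ici s := by
    ext r
    change (t < r ∧ Real.exp (σ * t) ≤ drive σ f t r) ↔ s ≤ r
    rw [← hseq, hmono.le_iff_le]
    exact ⟨fun h => h.2, fun h => ⟨hts.trans_le h, h⟩⟩
  have heq : firingMap σ f t = s := by
    rw [firingMap, hset, csInf_Ici]
  rw [heq]
  exact ⟨hts, hs.2, hseq⟩

theorem eq_firingMap (hσ : 0 ≤ σ) (hς : 0 < ς) (hf : MemLInftyLoc f)
    (hpos : ∀ᵐ t : ℝ, ς ≤ f t - σ) {t s : ℝ} (h : drive σ f t s = Real.exp (σ * t)) :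
    s = firingMap σ f t := by
  have hmono : StrictMono (drive σ f t) := fun a b hab => drive_lt hσ hς hf hpos hab
  exact hmono.injective (h.trans (firingMap_spec hσ hς hf hpos t).2.2.symm)

theorem firingMap_add_one (hσ : 0 ≤ σ) (hς : 0 < ς) (hf : MemLInftyLoc f)
    (hper : OnePeriodic f) (hpos : ∀ᵐ t : ℝ, ς ≤ f t - σ) (t : ℝ) :
    firingMap σ f (t + 1) = firingMap σ f t + 1 := by
  refine (eq_firingMap hσ hς hf hpos ?_).symm
  rw [drive_add_one hper, (firingMap_spec hσ hς hf hpos t).2.2, ← Real.exp_add]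
  ring_nf

/-- Subtracting the two threshold equations expresses the drive between firing times through that
between starting times. Monotonicity and the Lipschitz bound both rest on this. -/
theorem drive_firingMap_firingMap (hσ : 0 ≤ σ) (hς : 0 < ς) (hf : MemLInftyLoc f)
    (hpos : ∀ᵐ t : ℝ, ς ≤ f t - σ) (t s : ℝ) :
    drive σ f (firingMap σ f t) (firingMap σ f s) =
      drive σ f t s + (Real.exp (σ * s) - Real.exp (σ * t)) := by
  have h1 := (firingMap_spec hσ hς hf hpos t).2.2
  have h2 := (firingMap_spec hσ hς hf hpos s).2.2
  have h3 := drive_add (σ := σ) hf t (firingMap σ f t) (firingMap σ f s)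
  have h4 := drive_add (σ := σ) hf t s (firingMap σ f s)
  linarith

theorem monotone_firingMap (hσ : 0 ≤ σ) (hς : 0 < ς) (hf : MemLInftyLoc f)
    (hpos : ∀ᵐ t : ℝ, ς ≤ f t - σ) : Monotone (firingMap σ f) := by
  intro t s hts
  by_contra! hlt
  have h1 := drive_firingMap_firingMap hσ hς hf hpos t s
  have h2 := drive_lt (a := firingMap σ f t) hσ hς hf hpos hlt
  have h0 : drive σ f (firingMap σ f t) (firingMap σ f t) = 0 := intervalIntegral.integral_same
  have h3 : Real.exp (σ * t) ≤ Real.exp (σ * s) :=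
    Real.exp_le_exp.2 (mul_le_mul_of_nonneg_left hts hσ)
  have h4 := le_drive hσ hς.le hf hpos hts
  have h5 : 0 ≤ ς * Real.exp (σ * t) * (s - t) :=
    mul_nonneg (mul_pos hς (Real.exp_pos _)).le (sub_nonneg.2 hts)
  linarith

/-- The firing map as a lift of a degree one circle map. -/
noncomputable def firingLift (hσ : 0 ≤ σ) (hς : 0 < ς) (hf : MemLInftyLoc f)
    (hper : OnePeriodic f) (hpos : ∀ᵐ t : ℝ, ς ≤ f t - σ) : CircleDeg1Lift where
  toFun := firingMap σ f
  monotone' := monotone_firingMap hσ hς hf hpos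
  map_add_one' := firingMap_add_one hσ hς hf hper hpos

/-- For starts at most 1 apart the exponential weights are comparable up to `exp σ`, and the drive
identity gives a linear bound. For starts farther apart, `t < Φ t ≤ t + 1 / ς` suffices. -/
theorem exists_lipschitz_firingMap (hσ : 0 ≤ σ) (hς : 0 < ς) (hf : MemLInftyLoc f)
    (hper : OnePeriodic f) (hpos : ∀ᵐ t : ℝ, ς ≤ f t - σ) :
    ∃ K : ℝ, 0 ≤ K ∧ ∀ t s, |firingMap σ f t - firingMap σ f s| ≤ K * |t - s| := by
  obtain ⟨M₀, hM₀⟩ := hf.exists_ae_abs_le hper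
  set M := max M₀ 0
  have hM : 0 ≤ M := le_max_right _ _
  have hle : ∀ᵐ t : ℝ, f t - σ ≤ M := by
    filter_upwards [hM₀] with t ht
    have := (abs_le.1 (ht.trans (le_max_left M₀ 0))).2
    linarith
  set K₁ := (M + σ) * Real.exp σ / ς with hK₁
  have hK₁0 : 0 ≤ K₁ := by positivity
  have hi : 0 < 1 / ς := by positivity
  refine ⟨K₁ + (1 + 1 / ς), by positivity, ?_⟩
  suffices H : ∀ t s, t ≤ s →
      firingMap σ f s - firingMap σ f t ≤ (K₁ + (1 + 1 / ς)) * (s - t) by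
    intro t s
    rcases le_total t s with h | h
    · rw [abs_sub_comm, abs_of_nonneg (sub_nonneg.2 (monotone_firingMap hσ hς hf hpos h)),
        abs_sub_comm, abs_of_nonneg (sub_nonneg.2 h)]
      exact H t s h
    · rw [abs_of_nonneg (sub_nonneg.2 (monotone_firingMap hσ hς hf hpos h)),
        abs_of_nonneg (sub_nonneg.2 h)]
      exact H s t h
  intro t s hts
  obtain ⟨ht1, -, -⟩ := firingMap_spec hσ hς hf hpos t
  obtain ⟨-, hs2, -⟩ := firingMap_spec hσ hς hf hpos s
  have hst := sub_nonneg.2 hts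
  rcases le_total (s - t) 1 with h1 | h1
  · have hmono := monotone_firingMap hσ hς hf hpos hts
    have a1 := le_drive hσ hς.le hf hpos hmono
    rw [drive_firingMap_firingMap hσ hς hf hpos t s] at a1
    have a2 := drive_le hσ hM hf hle hts
    have a3 : Real.exp (σ * s) - Real.exp (σ * t) ≤ σ * Real.exp (σ * s) * (s - t) := by
      have e : Real.exp (σ * t) = Real.exp (σ * s) * Real.exp (σ * t - σ * s) := by
        rw [← Real.exp_add]
        ring_nf
      have := Real.add_one_le_exp (σ * t - σ * s)
      rw [e]
      nlinarith [Real.exp_pos (σ * s)]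
    have a4 : Real.exp (σ * s) ≤ Real.exp σ * Real.exp (σ * firingMap σ f t) := by
      rw [← Real.exp_add]
      refine Real.exp_le_exp.2 ?_
      nlinarith
    set D := firingMap σ f s - firingMap σ f t
    set E := Real.exp (σ * firingMap σ f t) with hE
    have hE0 : 0 < E := Real.exp_pos _
    have a5 : ς * E * D ≤ (M + σ) * (Real.exp σ * E) * (s - t) := by
      have : (M + σ) * Real.exp (σ * s) * (s - t) ≤ (M + σ) * (Real.exp σ * E) * (s - t) := by
        gcongr
      nlinarith
    have a6 : D ≤ K₁ * (s - t) := by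
      have e : K₁ * (s - t) = (M + σ) * (Real.exp σ * E) * (s - t) / (ς * E) := by
        rw [hK₁]
        field_simp
      rw [e, le_div_iff₀ (by positivity)]
      linarith
    nlinarith
  · nlinarith

/-- Firing maps depend continuously on the input, uniformly in time. -/
theorem abs_firingMap_sub_firingMap_le (hσ : 0 ≤ σ) (hς : 0 < ς) (hf : MemLInftyLoc f)
    (hg : MemLInftyLoc g) (hfpos : ∀ᵐ t : ℝ, ς ≤ f t - σ) (hgpos : ∀ᵐ t : ℝ, ς ≤ g t - σ) {η : ℝ}
    (h : ∀ᵐ t : ℝ, |f t - g t| ≤ η) (t : ℝ) :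
    |firingMap σ f t - firingMap σ g t| ≤ η * (Real.exp (σ / ς) / ς ^ 2) := by
  have hη : 0 ≤ η := by
    obtain ⟨u, hu⟩ := h.exists
    exact (abs_nonneg _).trans hu
  obtain ⟨hf1, -, hf3⟩ := firingMap_spec hσ hς hf hfpos t
  obtain ⟨hg1, hg2, hg3⟩ := firingMap_spec hσ hς hg hgpos t
  set a := firingMap σ f t
  set b := firingMap σ g t
  -- Both firing times meet the same threshold `exp (σ * t)`, so the drive of `f` from `a` to `b` is
  -- the difference of the two drives over `[t, b]`.
  have key : |drive σ f a b| ≤ η * Real.exp (σ * b) * (b - t) := by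
    have h1 := abs_drive_sub_drive_le hσ hf hg h hg1.le
    have h2 := drive_add (σ := σ) hf t a b
    rwa [hg3, ← hf3, ← h2, add_sub_cancel_left] at h1
  have low : ∀ x y, t ≤ x → x ≤ y → ς * Real.exp (σ * t) * (y - x) ≤ drive σ f x y := by
    intro x y htx hxy
    refine le_trans ?_ (le_drive hσ hς.le hf hfpos hxy)
    have : Real.exp (σ * t) ≤ Real.exp (σ * x) :=
      Real.exp_le_exp.2 (mul_le_mul_of_nonneg_left htx hσ)
    have := sub_nonneg.2 hxy
    gcongr
  have low' : ς * Real.exp (σ * t) * |a - b| ≤ |drive σ f a b| := by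
    rcases le_total a b with hab | hab
    · rw [abs_sub_comm, abs_of_nonneg (sub_nonneg.2 hab)]
      exact (low a b hf1.le hab).trans (le_abs_self _)
    · rw [abs_of_nonneg (sub_nonneg.2 hab), drive_symm, abs_neg]
      exact (low b a hg1.le hab).trans (le_abs_self _)
  have up : η * Real.exp (σ * b) * (b - t) ≤ η * (Real.exp (σ * t) * Real.exp (σ / ς)) * (1 / ς) := by
    have e1 : Real.exp (σ * b) ≤ Real.exp (σ * t) * Real.exp (σ / ς) := by
      rw [← Real.exp_add]
      refine Real.exp_le_exp.2 ?_
      have := mul_le_mul_of_nonneg_left hg2 hσ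
      rw [mul_add, mul_one_div] at this
      exact this
    have e2 : b - t ≤ 1 / ς := by linarith
    have e3 := sub_nonneg.2 hg1.le
    gcongr
  have fin := (low'.trans key).trans up
  have hE : 0 < ς * Real.exp (σ * t) := mul_pos hς (Real.exp_pos _)
  have e : η * (Real.exp (σ / ς) / ς ^ 2) =
      η * (Real.exp (σ * t) * Real.exp (σ / ς)) * (1 / ς) / (ς * Real.exp (σ * t)) := by
    field_simp
  rw [e, le_div_iff₀ hE]
  linarith

end drive

/-! ### Invariant measures of the phase map -/

theorem periodic_comp_lift {h : ℝ → ℝ} (hper : Function.Periodic h 1) (f : CircleDeg1Lift) :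
    Function.Periodic (fun x => h (f x)) 1 := fun x => by
  change h (f (x + 1)) = h (f x)
  rw [f.map_add_one, hper]

theorem periodic_displacement (f : CircleDeg1Lift) (g : ℝ → ℝ) :
    Function.Periodic (fun x => g (f x - x)) 1 := fun x => by
  change g (f (x + 1) - (x + 1)) = g (f x - x)
  rw [f.map_add_one, add_sub_add_right_eq_sub]

/-- An invariant measure is its own image under a map into `[0, 1)`, so the endpoint `1` has no
mass. -/
theorem IsInvariantPhaseMeasure.compl_Ico {Φ : ℝ → ℝ} {μ : Measure ℝ}
    (h : IsInvariantPhaseMeasure Φ μ) : μ (Set.Ico 0 1)ᶜ = 0 := by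
  rw [← h.invariant.measure_preimage measurableSet_Ico.compl.nullMeasurableSet]
  have : (fun t => Int.fract (Φ t)) ⁻¹' (Set.Ico (0 : ℝ) 1)ᶜ = ∅ := by
    ext x
    simp [Int.fract_nonneg, Int.fract_lt_one]
  rw [this, measure_empty]

theorem IsInvariantPhaseMeasure.integral_comp_iterate {f : CircleDeg1Lift} (hf : Continuous f)
    {μ : Measure ℝ} (hμ : IsInvariantPhaseMeasure f μ) {h : ℝ → ℝ} (hc : Continuous h)
    (hper : Function.Periodic h 1) (i : ℕ) : ∫ x, h (f^[i] x) ∂μ = ∫ x, h x ∂μ := by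
  have step : ∀ {h : ℝ → ℝ}, Continuous h → Function.Periodic h 1 →
      ∫ x, h (f x) ∂μ = ∫ x, h x ∂μ := by
    intro h hc hper
    have e : ∫ x, h x ∂μ = ∫ x, h x ∂(μ.map fun t => Int.fract (f t)) := by
      rw [hμ.invariant.map_eq]
    rw [e, integral_map hμ.invariant.measurable.aemeasurable hc.aestronglyMeasurable]
    simp only [periodic_map_fract hper]
  induction i generalizing h with
  | zero => rfl
  | succ i ih =>
    simp only [Function.iterate_succ_apply']
    rw [ih (h := fun x => h (f x)) (hc.comp hf) (periodic_comp_lift hper f), step hc hper]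

/-- A Birkhoff average with small oscillation is close to the space average. -/
theorem IsInvariantPhaseMeasure.abs_sum_sub_integral_le {f : CircleDeg1Lift} (hf : Continuous f)
    {μ : Measure ℝ} (hμ : IsInvariantPhaseMeasure f μ) {h : ℝ → ℝ} {L : ℝ} (hL : 0 ≤ L)
    (hper : Function.Periodic h 1) (hlip : ∀ x y, |h x - h y| ≤ L * |x - y|) {N : ℕ} {C : ℝ}
    (t : ℝ) (hosc : ∀ s, |∑ i ∈ Finset.range N, h (f^[i] s)
      - ∑ i ∈ Finset.range N, h (f^[i] t)| ≤ C) :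
    |∑ i ∈ Finset.range N, h (f^[i] t) - N * ∫ x, h x ∂μ| ≤ C := by
  have := hμ.prob
  have hc := continuous_of_abs_sub_le hL hlip
  have hint : ∀ i, Integrable (fun x => h (f^[i] x)) μ := fun i =>
    Integrable.of_bound (hc.comp (hf.iterate i)).aestronglyMeasurable (|h 0| + L)
      (Eventually.of_forall fun x => abs_le_of_periodic hL hper hlip _)
  have hS : ∫ s, (∑ i ∈ Finset.range N, h (f^[i] s)) ∂μ = N * ∫ x, h x ∂μ := by
    rw [integral_finsetSum _ fun i _ => hint i]
    simp [hμ.integral_comp_iterate hf hc hper]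
  have hdiff : ∫ s, (∑ i ∈ Finset.range N, h (f^[i] s) - ∑ i ∈ Finset.range N, h (f^[i] t)) ∂μ
      = N * ∫ x, h x ∂μ - ∑ i ∈ Finset.range N, h (f^[i] t) := by
    rw [integral_sub (integrable_finsetSum _ fun i _ => hint i) (integrable_const _), hS]
    simp
  rw [abs_sub_comm, ← hdiff]
  have := norm_integral_le_of_norm_le_const (μ := μ) (C := C)
    (f := fun s => ∑ i ∈ Finset.range N, h (f^[i] s) - ∑ i ∈ Finset.range N, h (f^[i] t))
    (Eventually.of_forall hosc)
  simpa using this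

/-- Krylov–Bogolyubov along the orbit of `0`: averages of `h` and `h ∘ f` differ by two boundary
terms over `n`. The Lipschitz bound on `f` keeps `h ∘ f` among the test functions. -/
theorem exists_isInvariantPhaseMeasure {f : CircleDeg1Lift} {K : ℝ} (hK : 0 ≤ K)
    (hf : ∀ x y, |f x - f y| ≤ K * |x - y|) : ∃ μ, IsInvariantPhaseMeasure f μ := by
  have hfc : Continuous f := continuous_of_abs_sub_le hK hf
  obtain ⟨ν, G, hν, hνK, hG, hlim⟩ := exists_ultrafilter_tendsto_empirical
    (y := fun i => Int.fract (f^[i] 0)) (K := Set.Icc 0 1) isCompact_Icc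
    (fun i => ⟨Int.fract_nonneg _, (Int.fract_lt_one _).le⟩)
  -- The cluster point may charge `1`; taking fractional parts moves that mass to `0` without
  -- changing integrals of periodic functions.
  set μ := ν.map Int.fract with hμ
  have hIco : ∀ (m : Measure ℝ) (φ : ℝ → ℝ), Measurable φ →
      (m.map fun x => Int.fract (φ x)) (Set.Ico 0 1)ᶜ = 0 := fun m φ hφ => by
    have hm : Measurable fun x => Int.fract (φ x) := measurable_fract.comp hφ
    rw [Measure.map_apply hm measurableSet_Ico.compl]
    have : (fun x => Int.fract (φ x)) ⁻¹' (Set.Ico (0 : ℝ) 1)ᶜ = ∅ := by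
      ext x
      simp [Int.fract_nonneg, Int.fract_lt_one]
    rw [this, measure_empty]
  have hμP : IsProbabilityMeasure μ := Measure.isProbabilityMeasure_map measurable_fract.aemeasurable
  have hμI : μ (Set.Ico 0 1)ᶜ = 0 := hIco ν id measurable_id
  have hlimμ : ∀ (h : ℝ → ℝ) (L : ℝ), 0 ≤ L → Function.Periodic h 1 →
      (∀ x y, |h x - h y| ≤ L * |x - y|) →
      Tendsto (fun n : ℕ => (∑ i ∈ Finset.range n, h (f^[i] 0)) / (n : ℝ)) G
        (𝓝 (∫ x, h x ∂μ)) := by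
    intro h L hL hper hlip
    have hc := continuous_of_abs_sub_le hL hlip
    have := hlim h hc ⟨_, abs_le_of_periodic hL hper hlip⟩
    rw [hμ, integral_map measurable_fract.aemeasurable hc.aestronglyMeasurable]
    simpa only [periodic_map_fract hper] using this
  have hφ : Measurable fun t => Int.fract (f t) := measurable_fract.comp hfc.measurable
  refine ⟨μ, hμP, ?_, hφ, ?_⟩
  · exact measure_mono_null (Set.compl_subset_compl.2 Set.Ico_subset_Icc_self) hμI
  have : IsProbabilityMeasure (μ.map fun t => Int.fract (f t)) :=
    Measure.isProbabilityMeasure_map hφ.aemeasurable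
  refine eq_of_forall_integral_periodic_eq (hIco μ f hfc.measurable) hμI ?_
  rintro h hper ⟨L, hL⟩
  rw [integral_map hφ.aemeasurable hL.continuous.aestronglyMeasurable]
  simp only [periodic_map_fract hper]
  have hlip : ∀ x y, |h x - h y| ≤ L * |x - y| := fun x y => hL.dist_le_mul x y
  have l1 := hlimμ h L L.coe_nonneg hper hlip
  have l2 := hlimμ (fun x => h (f x)) (L * K) (mul_nonneg L.coe_nonneg hK) (periodic_comp_lift hper f)
    fun x y => (hlip _ _).trans (by
      rw [mul_assoc]
      exact mul_le_mul_of_nonneg_left (hf x y) L.coe_nonneg)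
  have l3 : Tendsto (fun n : ℕ => (∑ i ∈ Finset.range n, h (f (f^[i] 0))) / (n : ℝ)
      - (∑ i ∈ Finset.range n, h (f^[i] 0)) / (n : ℝ)) atTop (𝓝 0) := by
    have hz : Tendsto (fun n : ℕ => (2 * (|h 0| + L)) / (n : ℝ)) atTop (𝓝 0) :=
      tendsto_const_div_atTop_nhds_zero_nat _
    refine squeeze_zero_norm (fun n => ?_) hz
    have e := Finset.sum_range_succ (fun i => h (f^[i] 0)) n
    rw [Finset.sum_range_succ'] at e
    simp only [Function.iterate_succ_apply'] at e
    have e' : ∑ i ∈ Finset.range n, h (f (f^[i] 0)) - ∑ i ∈ Finset.range n, h (f^[i] 0)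
        = h (f^[n] 0) - h (f^[0] 0) := by linarith
    rw [← sub_div, e', norm_div, Real.norm_eq_abs, Real.norm_natCast]
    gcongr
    have b1 := abs_le_of_periodic L.coe_nonneg hper hlip (f^[n] 0)
    have b2 := abs_le_of_periodic L.coe_nonneg hper hlip (f^[0] 0)
    exact (abs_sub _ _).trans (by linarith)
  have l4 := tendsto_nhds_unique (l2.sub l1) (l3.mono_left hG)
  linarith

theorem IsInvariantPhaseMeasure.unique {f : CircleDeg1Lift} (hf : Continuous f)
    (hirr : Irrational f.translationNumber) {μ μ' : Measure ℝ}
    (hμ : IsInvariantPhaseMeasure f μ) (hμ' : IsInvariantPhaseMeasure f μ') : μ' = μ := by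
  have := hμ.prob
  have := hμ'.prob
  refine eq_of_forall_integral_periodic_eq hμ'.compl_Ico hμ.compl_Ico ?_
  rintro h hper ⟨L, hL⟩
  have hL1 : (0 : ℝ) < L + 1 := by positivity
  have hlip : ∀ x y, |h x - h y| ≤ (L + 1) * |x - y| := fun x y =>
    (hL.dist_le_mul x y).trans (by
      rw [Real.dist_eq]
      gcongr
      linarith)
  refine eq_of_forall_dist_le fun ε hε => ?_
  obtain ⟨N, hN, hosc⟩ := exists_abs_birkhoff_sub_le hirr (ε := ε / (2 * (L + 1))) (by positivity)
  have hN' : (0 : ℝ) < N := by exact_mod_cast hN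
  have h1 := hμ.abs_sum_sub_integral_le hf hL1.le hper hlip 0 (hosc _ h hL1 hper hlip 0)
  have h2 := hμ'.abs_sum_sub_integral_le hf hL1.le hper hlip 0 (hosc _ h hL1 hper hlip 0)
  have e : (N : ℝ) * ((L + 1) * (ε / (2 * (L + 1)))) = N * (ε / 2) := by field_simp
  rw [e, abs_le] at h1 h2
  rw [Real.dist_eq, abs_le]
  constructor <;> refine le_of_mul_le_mul_left ?_ hN' <;> linarith [h1.1, h1.2, h2.1, h2.2]

/-! ### Perturbation of interspike intervals -/

/-- The errors satisfy `e (i + 1) ≤ K * e i + κ`, and `κ * (K + 1) ^ i` is a supersolution. -/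
theorem abs_iterate_sub_iterate_le {Φ Ψ : ℝ → ℝ} {K κ : ℝ} (hK : 0 ≤ K) (hκ : 0 ≤ κ)
    (hΦ : ∀ x y, |Φ x - Φ y| ≤ K * |x - y|) (h : ∀ x, |Ψ x - Φ x| ≤ κ) (i : ℕ) (t : ℝ) :
    |Ψ^[i] t - Φ^[i] t| ≤ κ * (K + 1) ^ i := by
  induction i with
  | zero => simpa using hκ
  | succ i ih =>
    rw [Function.iterate_succ_apply', Function.iterate_succ_apply']
    have h1 := h (Ψ^[i] t)
    have h2 := (hΦ (Ψ^[i] t) (Φ^[i] t)).trans (mul_le_mul_of_nonneg_left ih hK)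
    have h3 : κ * 1 ≤ κ * (K + 1) ^ i := by
      gcongr
      exact one_le_pow₀ (by linarith)
    have h4 := abs_sub_le (Ψ (Ψ^[i] t)) (Φ (Ψ^[i] t)) (Φ (Φ^[i] t))
    rw [pow_succ]
    nlinarith

theorem abs_isi_sub_isi_le {Φ Ψ : ℝ → ℝ} {K κ : ℝ} (hK : 0 ≤ K) (hκ : 0 ≤ κ)
    (hΦ : ∀ x y, |Φ x - Φ y| ≤ K * |x - y|) (h : ∀ x, |Ψ x - Φ x| ≤ κ) {N i : ℕ} (hi : i < N)
    (t : ℝ) : |isi Ψ t i - isi Φ t i| ≤ 2 * (κ * (K + 1) ^ N) := by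
  have key : ∀ j ≤ N, |Ψ^[j] t - Φ^[j] t| ≤ κ * (K + 1) ^ N := fun j hj =>
    (abs_iterate_sub_iterate_le hK hκ hΦ h j t).trans (by
      gcongr
      linarith)
  have h1 := abs_le.1 (key i hi.le)
  have h2 := abs_le.1 (key (i + 1) hi)
  rw [isi, isi, abs_le]
  constructor <;> linarith [h1.1, h1.2, h2.1, h2.2]

theorem isi_eq (Φ : ℝ → ℝ) (t : ℝ) (i : ℕ) : isi Φ t i = Φ (Φ^[i] t) - Φ^[i] t := by
  rw [isi, Function.iterate_succ_apply']

theorem isi_add (Φ : ℝ → ℝ) (t : ℝ) (k i : ℕ) : isi Φ t (k + i) = isi Φ (Φ^[k] t) i := by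
  simp only [isi, ← Function.iterate_add_apply]
  rw [add_comm k i, add_right_comm]

theorem abs_displacement_sub_le {Φ g : ℝ → ℝ} {K L : ℝ} (hL : 0 ≤ L)
    (hΦ : ∀ x y, |Φ x - Φ y| ≤ K * |x - y|) (hg : ∀ x y, |g x - g y| ≤ L * |x - y|) (x y : ℝ) :
    |g (Φ x - x) - g (Φ y - y)| ≤ L * (K + 1) * |x - y| := by
  refine (hg _ _).trans ?_
  rw [mul_assoc]
  refine mul_le_mul_of_nonneg_left ?_ hL
  have e : Φ x - x - (Φ y - y) = (Φ x - Φ y) - (x - y) := by ring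
  rw [e]
  refine (abs_sub _ _).trans ?_
  linarith [hΦ x y]

/-- Weak convergence of empirical measures in a compact interval extends to unbounded continuous
test functions. -/
theorem WeaklyConverges.tendsto_average {y : ℕ → ℝ} {a b : ℝ} (hab : a ≤ b)
    (hy : ∀ i, y i ∈ Set.Icc a b) {ν : Measure ℝ} (hν : ν (Set.Icc a b)ᶜ = 0)
    (h : WeaklyConverges (empirical y) ν) {g : ℝ → ℝ} (hg : Continuous g) :
    Tendsto (fun n : ℕ => (∑ i ∈ Finset.range n, g (y i)) / n) atTop (𝓝 (∫ x, g x ∂ν)) := by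
  obtain ⟨C, hC⟩ := isCompact_Icc.exists_bound_of_continuousOn (s := Set.Icc a b) hg.continuousOn
  have hproj : Continuous fun x => g (Set.projIcc a b hab x) :=
    hg.comp (continuous_subtype_val.comp continuous_projIcc)
  have key := h (BoundedContinuousFunction.ofNormedAddCommGroup _ hproj C
    fun x => hC _ (Set.projIcc a b hab x).2)
  simp only [BoundedContinuousFunction.coe_ofNormedAddCommGroup, integral_empirical] at key
  have e1 : ∫ x, g (Set.projIcc a b hab x) ∂ν = ∫ x, g x ∂ν := by
    refine integral_congr_ae ?_
    filter_upwards [mem_ae_iff.2 hν] with x hx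
    rw [Set.projIcc_of_mem hab hx]
  rw [e1] at key
  refine key.congr fun n => ?_
  congr 1
  refine Finset.sum_congr rfl fun i _ => ?_
  rw [Set.projIcc_of_mem hab (hy i)]

end IntegrateFire

/-! ### Choice of the neighbourhood and proof of the proposition -/

open IntegrateFire in
theorem mainTheorem9 (σ : ℝ) (hσ : 0 ≤ σ) (f₁ : ℝ → ℝ)
    (hf₁ : IntegrateFire.MemLInftyLoc f₁)
    (hper₁ : IntegrateFire.OnePeriodic f₁)
    (hpos₁ : ∃ ς : ℝ, 0 < ς ∧ ∀ᵐ t : ℝ, ς < f₁ t - σ)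
    (hrot₁ : Irrational (IntegrateFire.rotationNumber (IntegrateFire.firingMap σ f₁))) :
    ∃ μ : Measure ℝ,
      IntegrateFire.IsInvariantPhaseMeasure (IntegrateFire.firingMap σ f₁) μ ∧
      (∀ μ' : Measure ℝ,
        IntegrateFire.IsInvariantPhaseMeasure (IntegrateFire.firingMap σ f₁) μ' → μ' = μ) ∧
      ∀ ε : ℝ, 0 < ε → ∃ U : Set (ℝ → ℝ), IntegrateFire.IsNhdLInftyLoc U f₁ ∧
        ∀ f₂ : ℝ → ℝ, f₂ ∈ U → IntegrateFire.MemLInftyLoc f₂ →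
          IntegrateFire.OnePeriodic f₂ → ∀ t : ℝ,
            ∃ ν : Measure ℝ, IsProbabilityMeasure ν ∧
              IntegrateFire.WeaklyConverges
                (fun n => IntegrateFire.empiricalISI (IntegrateFire.firingMap σ f₂) n t) ν ∧
              IntegrateFire.fortetMourierDist ν
                (IntegrateFire.isiDistribution (IntegrateFire.firingMap σ f₁) μ)
                  < ENNReal.ofReal ε := by
  obtain ⟨ς₀, hς₀, hpos₀⟩ := hpos₁
  -- Halving leaves room for a perturbation of size `ς` to keep the same lower bound `ς`.
  set ς := ς₀ / 2 with hςdef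
  have hς : 0 < ς := half_pos hς₀
  have hpos : ∀ᵐ t : ℝ, ς ≤ f₁ t - σ := by
    filter_upwards [hpos₀] with t ht
    linarith
  set Φ := firingLift hσ hς hf₁ hper₁ hpos
  obtain ⟨K, hK, hlip⟩ := exists_lipschitz_firingMap hσ hς hf₁ hper₁ hpos
  have hΦc : Continuous Φ := continuous_of_abs_sub_le hK hlip
  have hirr : Irrational Φ.translationNumber := by
    have : rotationNumber (firingMap σ f₁) = Φ.translationNumber := by
      have h := Φ.tendsto_translation_number₀
      simp only [CircleDeg1Lift.coe_pow] at h
      exact h.limUnder_eq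
    rwa [← this]
  obtain ⟨μ, hμ⟩ := exists_isInvariantPhaseMeasure (f := Φ) hK hlip
  refine ⟨μ, hμ, fun μ' hμ' => hμ.unique hΦc hirr hμ', fun ε hε => ?_⟩
  have hK1 : 0 < K + 1 := by linarith
  -- For 1-Lipschitz `g`, `g (Φ x - x)` is `(K + 1)`-Lipschitz in `x`, so its block averages
  -- oscillate by at most `ε / 8`; `N` does not depend on `g`.
  obtain ⟨N, hN, hosc⟩ := exists_abs_birkhoff_sub_le hirr (ε := ε / 8 / (K + 1)) (by positivity)
  -- Chosen so that the interval error `2 * (κ * (K + 1) ^ N)` equals `ε / 8`.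
  set κ := ε / (16 * (K + 1) ^ N) with hκdef
  have hκ : 0 < κ := by positivity
  set R := Real.exp (σ / ς) / ς ^ 2 with hR
  have hRpos : 0 < R := by positivity
  set η := min ς (κ / R) with hη
  have hηpos : 0 < η := lt_min hς (by positivity)
  refine ⟨{g | supDistOn 1 f₁ g < η}, ⟨1 / 2 * (η / (1 + η)), by positivity,
    fun g _ hg => supDistOn_lt_of_distLInftyLoc_lt hηpos hg⟩, fun f₂ hU hf₂ hper₂ t => ?_⟩
  have hclose := ae_abs_sub_le_of_supDistOn_le hf₁ hf₂ hper₁ hper₂ (le_of_lt hU)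
  have hpos₂ : ∀ᵐ t : ℝ, ς ≤ f₂ t - σ := by
    filter_upwards [hclose, hpos₀] with t h1 h2
    have h3 := (abs_le.1 h1).2
    have h4 : η ≤ ς := min_le_left _ _
    linarith
  set Ψ := firingLift hσ hς hf₂ hper₂ hpos₂
  obtain ⟨K₂, hK₂, hlip₂⟩ := exists_lipschitz_firingMap hσ hς hf₂ hper₂ hpos₂
  have hΨc : Continuous Ψ := continuous_of_abs_sub_le hK₂ hlip₂
  have hΨΦ : ∀ x, |firingMap σ f₂ x - firingMap σ f₁ x| ≤ κ := fun x => by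
    rw [abs_sub_comm]
    refine (abs_firingMap_sub_firingMap_le hσ hς hf₁ hf₂ hpos hpos₂ hclose x).trans ?_
    have : η ≤ κ / R := min_le_right _ _
    rwa [le_div_iff₀ hRpos] at this
  have hy : ∀ i, isi (firingMap σ f₂) t i ∈ Set.Icc 0 (1 / ς) := fun i => by
    obtain ⟨h1, h2, -⟩ := firingMap_spec hσ hς hf₂ hpos₂ ((firingMap σ f₂)^[i] t)
    rw [isi_eq]
    constructor <;> linarith
  obtain ⟨ν, hν, hνK, hweak⟩ := exists_weaklyConverges_empirical isCompact_Icc hy (by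
    rintro g ⟨L, hL⟩
    have hL1 : (0 : ℝ) < L + 1 := by positivity
    have hg : ∀ x y, |g x - g y| ≤ (L + 1) * |x - y| := fun x y =>
      (hL.dist_le_mul x y).trans (by
        rw [Real.dist_eq]
        gcongr
        linarith)
    have := exists_tendsto_birkhoff hΨc (h := fun x => g (Ψ x - x))
      (mul_pos hL1 (by linarith : 0 < K₂ + 1)) (periodic_displacement Ψ g)
      (abs_displacement_sub_le hL1.le hlip₂ hg) t
    simp only [isi_eq]
    exact this)
  refine ⟨ν, hν, hweak, ?_⟩
  -- A supremum preserves only weak bounds, so each `g` is bounded by `ε / 2`.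
  refine lt_of_le_of_lt (iSup₂_le fun g hg => ?_)
    ((ENNReal.ofReal_lt_ofReal_iff hε).2 (half_lt_self hε))
  refine ENNReal.ofReal_le_ofReal ?_
  have hg1 : ∀ x y, |g x - g y| ≤ 1 * |x - y| := fun x y => hg.dist_le_mul x y
  have hisi : ∫ x, g x ∂(isiDistribution (firingMap σ f₁) μ)
      = ∫ x, g (firingMap σ f₁ x - x) ∂μ := by
    rw [isiDistribution, integral_map _ hg.continuous.aestronglyMeasurable]
    exact ((hΦc.sub continuous_id).measurable).aemeasurable
  rw [hisi]
  set c := ∫ x, g (firingMap σ f₁ x - x) ∂μ with hc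
  have hlim := hweak.tendsto_average (by positivity) hy hνK hg.continuous
  have hΦavg : ∀ s, |∑ i ∈ Finset.range N, g (isi (firingMap σ f₁) s i) - N * c|
      ≤ N * (ε / 8) := fun s => by
    have hp := periodic_displacement Φ g
    have hl := abs_displacement_sub_le zero_le_one hlip hg1
    have h1 : (0 : ℝ) < 1 * (K + 1) := by linarith
    have := hμ.abs_sum_sub_integral_le hΦc h1.le hp hl s (hosc _ _ h1 hp hl s)
    have e : (N : ℝ) * (1 * (K + 1) * (ε / 8 / (K + 1))) = N * (ε / 8) := by field_simp
    rw [e] at this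
    simp only [isi_eq]
    exact this
  -- Each block average is within `ε / 4` of `c`: `ε / 8` for replacing `f₂` by `f₁` from the
  -- block's start, `ε / 8` for the unperturbed average.
  have hevent := eventually_abs_average_sub_le (a := fun i => g (isi (firingMap σ f₂) t i))
    (c := c) (B := |g 0| + 1 / ς) (ε := ε / 4) (ε' := ε / 2) hN (fun i => by
      have h1 := hg1 (isi (firingMap σ f₂) t i) 0
      have h2 := abs_sub_abs_le_abs_sub (g (isi (firingMap σ f₂) t i)) (g 0)
      rw [sub_zero, abs_of_nonneg (hy i).1] at h1
      linarith [(hy i).2]) (by positivity) (by linarith) (Eventually.of_forall fun k => by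
      simp only [isi_add]
      set s := (firingMap σ f₂)^[k * N] t
      have h1 : |∑ i ∈ Finset.range N, g (isi (firingMap σ f₂) s i)
          - ∑ i ∈ Finset.range N, g (isi (firingMap σ f₁) s i)| ≤ N * (ε / 8) := by
        rw [← Finset.sum_sub_distrib]
        refine (Finset.abs_sum_le_sum_abs _ _).trans ((Finset.sum_le_sum
          (g := fun _ => ε / 8) fun i hi => ?_).trans (by simp))
        refine (hg1 _ _).trans ?_
        rw [one_mul]
        refine (abs_isi_sub_isi_le hK hκ.le hlip hΨΦ (Finset.mem_range.1 hi) s).trans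
          (le_of_eq ?_)
        rw [hκdef]
        field_simp
        norm_num
      have h2 := hΦavg s
      rw [abs_le] at h1 h2 ⊢
      constructor <;> linarith [h1.1, h1.2, h2.1, h2.2])
  exact le_of_tendsto ((hlim.sub_const c).abs) hevent
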